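/- **Networks.** Fix a set $\mathcal A$ of measurable activation functions $\mathbb R\to\mathbb R$ containing ReLU, $t\mapsto\max(t,0)$. A *$k$-layer network* is a layered feed-forward network with $k$ layers of gates and arbitrary connections between consecutive layers (the first layer reads the input). Each gate applies an activation function to an affine function of the gates it is connected to in the previous layer. Hidden layers are non-empty and their gates use activations from $\mathcal A$; all gates of the last layer use ReLU. The number of parameters is the number of connections (weights) plus the number of gates (biases). **Setting.** Let $k\ge 2$ and let $\mathcal D_{real}$ be a probability distribution on $\mathbb R^d$. - The measuring function $\phi:[0,1]\to[-\Delta,\Delta]$ is concave and $L_\phi$-Lipschitz. - The generators $G_u:\mathbb R^\ell\to\mathbb R^d$ ($u\in\mathcal U$) and the discriminators $D_v:\mathbb R^d\to[0,1]$ ($v\in\mathcal V$) are $k$-layer networks with at most $p$ parameters, and $\mathcal U,\mathcal V$ are subsets of the unit ball of $\mathbb R^p$. - Generators and discriminators are $L$-Lipschitz in their parameters, $\|G_u(h)-G_{u'}(h)\|\le L\|u-u'\|$ and $|D_v(x)-D_{v'}(x)|\le L\|v-v'\|$ for all $h,x$, and $L'$-Lipschitz in their inputs. - The generators approximate point masses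 at the points of the real distribution: for $\mathcal D_{real}$-almost every $x$ and every $\eta>0$ there is $u\in\mathcal U$ with $\mathbb E_{h\sim N(0,I_\ell)}\|G_u(h)-x\|\le\eta$. For a generator $G:\mathbb R^n\to\mathbb R^d$ and a discriminator $D:\mathbb R^d\to[0,1]$ let $$F(G,D)=\mathbb E_{x\sim\mathcal D_{real}}[\phi(D(x))]+\mathbb E_{h\sim N(0,I_n)}[\phi(1-D(G(h)))].$$ For a class $\mathcal G$ of generators and a class $\mathcal D$ of discriminators, $(G,D)\in\mathcal G\times\mathcal D$ is an *$\epsilon$-approximate pure equilibrium with value $V$* if $F(G,D')\le V+\epsilon$ for all $D'\in\mathcal D$ and $F(G',D)\ge V-\epsilon$ for all $G'\in\mathcal G$. **Theorem.** There is a universal constant $C>0$ such that, in this setting, for every $\epsilon$ with $0<\epsilon\le 4\Delta$, if $L'\ge 1$ and $LL'L_\phi p/\epsilon\ge 2$, there is an integer $$N\le C\,\frac{\Delta^2p^2\log(LL'L_\phi p/\epsilon)}{\epsilon^2}$$ with the following properties. Let $\mathcal G_N$ be the class of all $(k+1)$-layer generator networks $\mathbb R^{\ell+1}\to\mathbb R^d$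 with at most $N$ parameters; their input is $N(0,I_{\ell+1})$, that is, they have one extra Gaussian input. Every $G_u$, with the extra input ignored, belongs to $\mathcal G_N$, and every $D_v$ is also a $(k+1)$-layer network with at most $N$ parameters. There are $G\in\mathcal G_N$ and a $(k+1)$-layer discriminator network $D:\mathbb R^d\to[0,1]$ with at most $N$ parameters such that $(G,D)$ is an $\epsilon$-approximate pure equilibrium with value $2\phi(1/2)$ of the game in which the generator is chosen from $\mathcal G_N$ and the discriminator from $\{D_v:v\in\mathcal V\}\cup\{D\}$. -/

import Mathlib

open MeasureTheory ProbabilityTheory Set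

namespace GAN

/-- The rectified linear unit. -/
noncomputable def relu (t : ℝ) : ℝ := max t 0

/-- The affine part of one layer, with `n` inputs and `m` gates: a set of connections
(`(j, i) ∈ edges` means that input `i` is wired to gate `j`), a weight on each connection,
and a bias at each gate. Weights off the connection set are never used. -/
structure AffineLayer (n m : ℕ) where
  edges : Finset (Fin m × Fin n)
  weight : Fin m → Fin n → ℝ
  bias : Fin m → ℝ

/-- The number of parameters of a layer: one weight for each connection, one bias for each gate. -/
def AffineLayer.numParams {n m : ℕ} (A : AffineLayer n m) : ℕ := A.edges.card + m

/-- The values that enter the activation functions of the gates. -/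
noncomputable def AffineLayer.preact {n m : ℕ} (A : AffineLayer n m) (x : Fin n → ℝ) :
    Fin m → ℝ :=
  fun j => (∑ i : Fin n, if (j, i) ∈ A.edges then A.weight j i * x i else 0) + A.bias j

/-- `Net 𝒜 k n m`: feed-forward neural networks with `k` layers of gates, `n` inputs and `m`
outputs. A gate in a hidden layer applies an activation function from `𝒜`; every gate in the last
layer applies ReLU. Hidden layers have at least one gate. -/
inductive Net (𝒜 : Set (ℝ → ℝ)) : ℕ → ℕ → ℕ → Type
  | output {n m : ℕ} (A : AffineLayer n m) : Net 𝒜 1 n m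
  | hidden {k n w m : ℕ} (A : AffineLayer n w) (hw : 0 < w) (σ : Fin w → 𝒜)
      (rest : Net 𝒜 k w m) : Net 𝒜 (k + 1) n m

/-- The function computed by a network. -/
noncomputable def Net.eval {𝒜 : Set (ℝ → ℝ)} :
    {k n m : ℕ} → Net 𝒜 k n m → (Fin n → ℝ) → Fin m → ℝ
  | _, _, _, .output A => fun x j => relu (A.preact x j)
  | _, _, _, .hidden A _ σ rest => fun x => rest.eval (fun j => (σ j : ℝ → ℝ) (A.preact x j))

/-- The number of parameters of a network. -/
def Net.numParams {𝒜 : Set (ℝ → ℝ)} : {k n m : ℕ} → Net 𝒜 k n m → ℕ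
  | _, _, _, .output A => A.numParams
  | _, _, _, .hidden A _ _ rest => A.numParams + rest.numParams

/-- The generators `ℝⁿ → ℝᵈ` that are `k`-layer networks with at most `N` parameters. -/
def generatorNets (𝒜 : Set (ℝ → ℝ)) (k N n d : ℕ) :
    Set (EuclideanSpace ℝ (Fin n) → EuclideanSpace ℝ (Fin d)) :=
  {G | ∃ 𝒩 : Net 𝒜 k n d, 𝒩.numParams ≤ N ∧ ∀ h, G h = WithLp.toLp 2 (𝒩.eval (WithLp.ofLp h))}

/-- The discriminators `ℝᵈ → [0, 1]` that are `k`-layer networks with at most `N` parameters. -/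
def discriminatorNets (𝒜 : Set (ℝ → ℝ)) (k N d : ℕ) :
    Set (EuclideanSpace ℝ (Fin d) → ℝ) :=
  {D | (∃ 𝒩 : Net 𝒜 k d 1, 𝒩.numParams ≤ N ∧ ∀ x, D x = 𝒩.eval (WithLp.ofLp x) 0) ∧
    ∀ x, D x ∈ Icc (0 : ℝ) 1}

/-- The distribution of `G h` for a standard Gaussian `h`. -/
noncomputable def generatedLaw {n d : ℕ}
    (G : EuclideanSpace ℝ (Fin n) → EuclideanSpace ℝ (Fin d)) :
    Measure (EuclideanSpace ℝ (Fin d)) :=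
  (stdGaussian (EuclideanSpace ℝ (Fin n))).map G

/-- The payoff (to the discriminator) with measuring function `φ` and real distribution `μ`. -/
noncomputable def payoff {n d : ℕ} (φ : ℝ → ℝ) (μ : Measure (EuclideanSpace ℝ (Fin d)))
    (G : EuclideanSpace ℝ (Fin n) → EuclideanSpace ℝ (Fin d))
    (D : EuclideanSpace ℝ (Fin d) → ℝ) : ℝ :=
  (∫ x, φ (D x) ∂μ) + ∫ x, φ (1 - D x) ∂(generatedLaw G)

/-- `(G, D)` is an `ε`-approximate pure equilibrium with value `V` of the zero-sum game with payoff
`F`, in which a minimizing player chooses from `𝒢` and a maximizing player from `𝒟`. -/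
def IsApproxPureEquilibrium {α β : Type*} (F : α → β → ℝ) (𝒢 : Set α) (𝒟 : Set β)
    (ε V : ℝ) (G : α) (D : β) : Prop :=
  G ∈ 𝒢 ∧ D ∈ 𝒟 ∧ (∀ D' ∈ 𝒟, F G D' ≤ V + ε) ∧ ∀ G' ∈ 𝒢, V - ε ≤ F G' D

/-- A function on `ℝⁿ` as a function on `ℝⁿ⁺¹` that ignores the first coordinate. -/
noncomputable def ignoreFirst {n d : ℕ}
    (G : EuclideanSpace ℝ (Fin n) → EuclideanSpace ℝ (Fin d)) :
    EuclideanSpace ℝ (Fin (n + 1)) → EuclideanSpace ℝ (Fin d) :=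
  fun h => G (WithLp.toLp 2 (fun i : Fin n => h i.succ))

end GAN

/-!
Against the discriminator that is constantly `1 / 2` every generator has payoff `2 * φ (1 / 2)`, so
the point is a generator whose law `ν` satisfies `∫ φ (1 - D) ∂ν ≤ ∫ φ (1 - D) ∂μ + ε` for all
discriminators `D` of the class; concavity of `φ` then bounds the payoff by `2 * φ (1 / 2) + ε`.

Such a law is the uniform mixture of `T` generators close to the point masses at `T` sampled points
of `μ`: by Hoeffding's inequality and a union bound, a suitable sample works for all discriminators
of a net in the parameter ball, and the Lipschitz condition extends this to the whole class.

The mixture is a single network: quantiles cut the extra Gaussian input into `T` intervals of equal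
mass, and the `i`-th generator has a sum `s` of two ReLU gates with `s = 0` exactly on the `i`-th
interval. Subtracting a large multiple of `s` before the last ReLU turns off all generators but one,
so their sum, computed by one more layer, is the output of the selected one.
-/

namespace GAN

lemma relu_nonneg (t : ℝ) : 0 ≤ relu t := le_max_right _ _

lemma relu_of_nonneg {t : ℝ} (ht : 0 ≤ t) : relu t = t := max_eq_left ht

lemma relu_of_nonpos {t : ℝ} (ht : t ≤ 0) : relu t = 0 := max_eq_right ht

lemma relu_eq_zero_iff {t : ℝ} : relu t = 0 ↔ t ≤ 0 := max_eq_right_iff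

lemma measurable_relu : Measurable relu := measurable_id.max measurable_const

lemma append_map₂ {m₁ m₂ : ℕ} {α β γ : Type*} (f : α → β → γ) (a : Fin m₁ → α) (a' : Fin m₂ → α)
    (b : Fin m₁ → β) (b' : Fin m₂ → β) :
    (fun j => f (Fin.append a a' j) (Fin.append b b' j)) =
      Fin.append (fun j => f (a j) (b j)) (fun j => f (a' j) (b' j)) := by
  funext j
  cases j using Fin.addCases <;> simp

lemma comp_append {m n : ℕ} {α β : Type*} (f : α → β) (a : Fin m → α) (b : Fin n → α) :
    f ∘ Fin.append a b = Fin.append (f ∘ a) (f ∘ b) := by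
  funext j
  cases j using Fin.addCases <;> simp

lemma castAdd_ne_natAdd {m n : ℕ} (i : Fin m) (j : Fin n) : Fin.castAdd n i ≠ Fin.natAdd m j :=
  Fin.ne_of_val_ne (i.2.trans_le (Nat.le_add_right m j)).ne

namespace AffineLayer

variable {n n' n₁ n₂ m m₁ m₂ : ℕ}

lemma measurable_preact (A : AffineLayer n m) : Measurable A.preact := by
  refine measurable_pi_lambda _ fun j => (Finset.measurable_sum _ fun i _ => ?_).add_const _
  split_ifs
  · exact (measurable_pi_apply i).const_mul _
  · exact measurable_const

/-- The layer with all weights present. -/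
noncomputable def full (W : Fin m → Fin n → ℝ) (b : Fin m → ℝ) : AffineLayer n m where
  edges := Finset.univ
  weight := W
  bias := b

@[simp]
lemma preact_full (W : Fin m → Fin n → ℝ) (b : Fin m → ℝ) (x : Fin n → ℝ) (j : Fin m) :
    (full W b).preact x j = (∑ i, W j i * x i) + b j := by
  simp [preact, full]

@[simp]
lemma card_edges_full (W : Fin m → Fin n → ℝ) (b : Fin m → ℝ) :
    (full W b).edges.card = m * n := by
  simp [full]

/-- The layer without connections, which outputs its biases. -/
noncomputable def const (n : ℕ) (b : Fin m → ℝ) : AffineLayer n m where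
  edges := ∅
  weight _ _ := 0
  bias := b

@[simp]
lemma preact_const (b : Fin m → ℝ) (x : Fin n → ℝ) : (const n b).preact x = b := by
  funext j
  simp [preact, const]

@[simp]
lemma card_edges_const (b : Fin m → ℝ) : (const n b).edges.card = 0 := by
  simp [const]

/-- The identity layer, with one connection at each gate. -/
noncomputable def copy (m : ℕ) : AffineLayer m m where
  edges := Finset.univ.diag
  weight _ _ := 1
  bias _ := 0

@[simp]
lemma preact_copy (x : Fin m → ℝ) : (copy m).preact x = x := by
  funext j
  simp [preact, copy]

@[simp]
lemma card_edges_copy : (copy m).edges.card = m := by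
  simp [copy]

/-- Precomposition of a layer with a rewiring of the inputs: input `i` of `A` reads `r i`. The
weights of inputs that read the same source are added. -/
noncomputable def comap (r : Fin n → Fin n') (A : AffineLayer n m) : AffineLayer n' m where
  edges := A.edges.image (Prod.map id r)
  weight j i' := ∑ i with r i = i', if (j, i) ∈ A.edges then A.weight j i else 0
  bias := A.bias

@[simp]
lemma preact_comap (r : Fin n → Fin n') (A : AffineLayer n m) (x : Fin n' → ℝ) :
    (A.comap r).preact x = A.preact (x ∘ r) := by
  funext j
  have weight_eq_zero : ∀ i', (j, i') ∉ (A.comap r).edges → (A.comap r).weight j i' = 0 := by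
    intro i' h
    exact Finset.sum_eq_zero (s := {i | r i = i'}) fun i hi => if_neg fun hji =>
      h (Finset.mem_image.2 ⟨(j, i), hji, congrArg (Prod.mk j) (Finset.mem_filter.1 hi).2⟩)
  have preact_eq : (A.comap r).preact x j = ∑ i', (A.comap r).weight j i' * x i' + A.bias j := by
    refine congrArg (· + A.bias j) (Finset.sum_congr rfl fun i' _ => ?_)
    split_ifs with h
    · rfl
    · rw [weight_eq_zero i' h, zero_mul]
  rw [preact_eq, preact, ← Finset.sum_fiberwise Finset.univ r]
  simp only [comap, Finset.sum_mul, Function.comp_apply]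
  refine congrArg (· + A.bias j) (Finset.sum_congr rfl fun i' _ => ?_)
  refine Finset.sum_congr rfl fun i hi => ?_
  rw [(Finset.mem_filter.1 hi).2, ite_mul, zero_mul]

lemma numParams_comap_le (r : Fin n → Fin n') (A : AffineLayer n m) :
    (A.comap r).numParams ≤ A.numParams :=
  Nat.add_le_add_right Finset.card_image_le _

/-- Two layers side by side, on separate inputs. -/
noncomputable def prod (A : AffineLayer n₁ m₁) (B : AffineLayer n₂ m₂) :
    AffineLayer (n₁ + n₂) (m₁ + m₂) where
  edges := A.edges.image (Prod.map (Fin.castAdd m₂) (Fin.castAdd n₂)) ∪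
    B.edges.image (Prod.map (Fin.natAdd m₁) (Fin.natAdd n₁))
  weight := Fin.append (fun j => Fin.append (A.weight j) 0) (fun j => Fin.append 0 (B.weight j))
  bias := Fin.append A.bias B.bias

@[simp]
lemma preact_prod (A : AffineLayer n₁ m₁) (B : AffineLayer n₂ m₂) (x : Fin n₁ → ℝ)
    (y : Fin n₂ → ℝ) :
    (A.prod B).preact (Fin.append x y) = Fin.append (A.preact x) (B.preact y) := by
  funext j
  cases j using Fin.addCases <;>
    simp [preact, prod, Fin.sum_univ_add, castAdd_ne_natAdd, (castAdd_ne_natAdd _ _).symm]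

lemma numParams_prod_le (A : AffineLayer n₁ m₁) (B : AffineLayer n₂ m₂) :
    (A.prod B).numParams ≤ A.numParams + B.numParams := by
  have hcard : (A.prod B).edges.card ≤ A.edges.card + B.edges.card :=
    (Finset.card_union_le _ _).trans (add_le_add Finset.card_image_le Finset.card_image_le)
  simp only [numParams]
  omega

/-- The sum of the affine functions of two layers on separate inputs. -/
noncomputable def add (A : AffineLayer n₁ m) (B : AffineLayer n₂ m) :
    AffineLayer (n₁ + n₂) m where
  edges := A.edges.image (Prod.map id (Fin.castAdd n₂)) ∪
    B.edges.image (Prod.map id (Fin.natAdd n₁))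
  weight j := Fin.append (A.weight j) (B.weight j)
  bias := A.bias + B.bias

@[simp]
lemma preact_add (A : AffineLayer n₁ m) (B : AffineLayer n₂ m) (x : Fin n₁ → ℝ)
    (y : Fin n₂ → ℝ) :
    (A.add B).preact (Fin.append x y) = A.preact x + B.preact y := by
  funext j
  simp only [preact, add, Fin.sum_univ_add, Fin.append_left, Fin.append_right, Pi.add_apply]
  simp [castAdd_ne_natAdd, (castAdd_ne_natAdd _ _).symm, add_add_add_comm]

lemma numParams_add_le (A : AffineLayer n₁ m) (B : AffineLayer n₂ m) :
    (A.add B).numParams ≤ A.numParams + B.edges.card := by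
  have hcard : (A.add B).edges.card ≤ A.edges.card + B.edges.card :=
    (Finset.card_union_le _ _).trans (add_le_add Finset.card_image_le Finset.card_image_le)
  simp only [numParams]
  omega

end AffineLayer

namespace Net

variable {𝒜 : Set (ℝ → ℝ)} {k n n' m n₁ n₂ q : ℕ}

lemma measurable_eval (h𝒜 : ∀ σ ∈ 𝒜, Measurable σ) (A : Net 𝒜 k n m) : Measurable A.eval := by
  induction A with
  | output A =>
    exact measurable_pi_lambda _ fun j =>
      measurable_relu.comp ((measurable_pi_apply j).comp A.measurable_preact)
  | hidden A _ σ _ ih =>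
    exact ih.comp (measurable_pi_lambda _ fun j =>
      (h𝒜 _ (σ j).2).comp ((measurable_pi_apply j).comp A.measurable_preact))

lemma depth_add_width_le (A : Net 𝒜 k n m) : k + m ≤ A.numParams + 1 := by
  induction A <;> simp only [numParams, AffineLayer.numParams] <;> omega

/-- The values that enter the ReLU gates of the last layer. -/
noncomputable def preoutput : {k n m : ℕ} → Net 𝒜 k n m → (Fin n → ℝ) → Fin m → ℝ
  | _, _, _, .output A => A.preact
  | _, _, _, .hidden A _ σ rest => fun x => rest.preoutput fun j => (σ j : ℝ → ℝ) (A.preact x j)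

lemma eval_apply (A : Net 𝒜 k n m) (x : Fin n → ℝ) (j : Fin m) :
    A.eval x j = relu (A.preoutput x j) := by
  induction A with
  | output A => rfl
  | hidden A _ σ _ ih => exact ih _ _

lemma eval_nonneg (A : Net 𝒜 k n m) (x : Fin n → ℝ) (j : Fin m) : 0 ≤ A.eval x j :=
  A.eval_apply x j ▸ relu_nonneg _

/-- Precomposition of a network with a rewiring of the inputs: input `i` of the network reads
`r i`. -/
noncomputable def comap (r : Fin n → Fin n') : Net 𝒜 k n m → Net 𝒜 k n' m
  | .output A => .output (A.comap r)
  | .hidden A hw σ rest => .hidden (A.comap r) hw σ rest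

@[simp]
lemma preoutput_comap (r : Fin n → Fin n') (A : Net 𝒜 k n m) (x : Fin n' → ℝ) :
    (A.comap r).preoutput x = A.preoutput (x ∘ r) := by
  cases A <;> simp [comap, preoutput]

@[simp]
lemma eval_comap (r : Fin n → Fin n') (A : Net 𝒜 k n m) (x : Fin n' → ℝ) :
    (A.comap r).eval x = A.eval (x ∘ r) := by
  funext j
  rw [eval_apply, eval_apply, preoutput_comap]

lemma numParams_comap_le (r : Fin n → Fin n') (A : Net 𝒜 k n m) :
    (A.comap r).numParams ≤ A.numParams := by
  cases A with
  | output A => exact A.numParams_comap_le r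
  | hidden A _ _ _ => exact Nat.add_le_add_right (A.numParams_comap_le r) _

/-- The network with `k + 1` layers that computes a constant function. -/
noncomputable def const (hrelu : relu ∈ 𝒜) : (k n : ℕ) → (Fin m → ℝ) → Net 𝒜 (k + 1) n m
  | 0, n, c => .output (.const n c)
  | _ + 1, n, c => .hidden (.const n 0) one_pos (fun _ => ⟨relu, hrelu⟩) (const hrelu _ 1 c)

@[simp]
lemma preoutput_const (hrelu : relu ∈ 𝒜) (c : Fin m → ℝ) (x : Fin n → ℝ) :
    (const hrelu k n c).preoutput x = c := by
  induction k generalizing n with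
  | zero => simp [const, preoutput]
  | succ _ ih => exact ih _

@[simp]
lemma numParams_const (hrelu : relu ∈ 𝒜) (c : Fin m → ℝ) :
    (const hrelu k n c).numParams = k + m := by
  induction k generalizing n with
  | zero => simp [const, numParams, AffineLayer.numParams]
  | succ _ ih => simp [const, numParams, AffineLayer.numParams, ih]; omega

/-- The network with `k + 1` layers that computes ReLU of an affine function; all layers after the
first one copy their inputs. -/
noncomputable def ofAffineLayer (hrelu : relu ∈ 𝒜) (hm : 0 < m) :
    (k : ℕ) → {n : ℕ} → AffineLayer n m → Net 𝒜 (k + 1) n m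
  | 0, _, A => .output A
  | _ + 1, _, A => .hidden A hm (fun _ => ⟨relu, hrelu⟩) (ofAffineLayer hrelu hm _ (.copy m))

@[simp]
lemma eval_ofAffineLayer (hrelu : relu ∈ 𝒜) (hm : 0 < m) (A : AffineLayer n m) (x : Fin n → ℝ)
    (j : Fin m) : (ofAffineLayer hrelu hm k A).eval x j = relu (A.preact x j) := by
  induction k generalizing n with
  | zero => rfl
  | succ k ih => simp [ofAffineLayer, eval, ih, relu_of_nonneg (relu_nonneg _)]

@[simp]
lemma numParams_ofAffineLayer (hrelu : relu ∈ 𝒜) (hm : 0 < m) (A : AffineLayer n m) :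
    (ofAffineLayer hrelu hm k A).numParams = A.numParams + k * (2 * m) := by
  induction k generalizing n with
  | zero => simp [ofAffineLayer, numParams]
  | succ k ih => simp [ofAffineLayer, numParams, AffineLayer.numParams, ih]; ring

/-- The network `A` with a parallel branch `C`, on separate inputs and one layer shorter, whose
outputs enter the last layer of `A` through the additional affine function `M`. -/
noncomputable def addBranch (hrelu : relu ∈ 𝒜) : {k n₁ n₂ q m : ℕ} → Net 𝒜 (k + 1) n₁ m →
    Net 𝒜 k n₂ q → AffineLayer q m → Net 𝒜 (k + 1) (n₁ + n₂) m
  | _, _, _, _, _, .hidden A hw σ (.output B), .output C, M =>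
      .hidden (A.prod C) (Nat.add_pos_left hw _) (Fin.append σ fun _ => ⟨relu, hrelu⟩)
        (.output (B.add M))
  | _, _, _, _, _, .hidden A hw σ rest, .hidden C _ τ rest', M =>
      .hidden (A.prod C) (Nat.add_pos_left hw _) (Fin.append σ τ) (addBranch hrelu rest rest' M)

@[simp]
lemma preoutput_addBranch (hrelu : relu ∈ 𝒜) (A : Net 𝒜 (k + 1) n₁ m) (C : Net 𝒜 k n₂ q)
    (M : AffineLayer q m) (x : Fin n₁ → ℝ) (y : Fin n₂ → ℝ) :
    (A.addBranch hrelu C M).preoutput (Fin.append x y) =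
      A.preoutput x + M.preact (C.eval y) := by
  fun_induction addBranch with
  | case1 _ _ _ A C B M =>
    simp [preoutput, eval, append_map₂]
  | case2 _ _ _ _ _ _ _ A C _ _ _ ih =>
    simp [preoutput, eval, append_map₂, ih]

lemma numParams_addBranch_le (hrelu : relu ∈ 𝒜) (A : Net 𝒜 (k + 1) n₁ m) (C : Net 𝒜 k n₂ q)
    (M : AffineLayer q m) :
    (A.addBranch hrelu C M).numParams ≤ A.numParams + C.numParams + M.edges.card := by
  fun_induction addBranch with
  | case1 _ _ _ A C B M =>
    have := A.numParams_prod_le C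
    have := B.numParams_add_le M
    simp only [numParams]
    omega
  | case2 _ _ _ _ _ _ _ A C _ _ _ ih =>
    have := A.numParams_prod_le C
    simp only [numParams]
    omega

/-- The sum of the outputs of several networks on a common input, as a network with one more layer:
the summands are branches of the zero network. -/
noncomputable def sum (hrelu : relu ∈ 𝒜) : {T : ℕ} → (Fin T → Net 𝒜 k n m) → Net 𝒜 (k + 1) n m
  | 0, _ => const hrelu k n 0
  | _ + 1, C =>
      ((sum hrelu (Fin.init C)).addBranch hrelu (C (Fin.last _)) (.copy m)).comap
        (Fin.append id id)

lemma preoutput_sum (hrelu : relu ∈ 𝒜) {T : ℕ} (C : Fin T → Net 𝒜 k n m) (x : Fin n → ℝ) :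
    (sum hrelu C).preoutput x = ∑ i, (C i).eval x := by
  induction T with
  | zero => simp [sum]
  | succ T ih =>
    simp [sum, comp_append, ih, Fin.sum_univ_castSucc, Fin.init]

@[simp]
lemma eval_sum (hrelu : relu ∈ 𝒜) {T : ℕ} (C : Fin T → Net 𝒜 k n m) (x : Fin n → ℝ) :
    (sum hrelu C).eval x = ∑ i, (C i).eval x := by
  funext j
  rw [eval_apply, preoutput_sum, Finset.sum_apply]
  exact relu_of_nonneg (Finset.sum_nonneg fun i _ => (C i).eval_nonneg x j)

lemma numParams_sum_le (hrelu : relu ∈ 𝒜) {T c : ℕ} (C : Fin T → Net 𝒜 k n m)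
    (hC : ∀ i, (C i).numParams ≤ c) :
    (sum hrelu C).numParams ≤ k + m + T * (c + m) := by
  induction T with
  | zero => simp [sum]
  | succ T ih =>
    calc (sum hrelu C).numParams
        ≤ (sum hrelu (Fin.init C)).numParams + (C (Fin.last T)).numParams + m :=
          (numParams_comap_le _ _).trans <|
            (numParams_addBranch_le _ _ _ _).trans_eq (by rw [AffineLayer.card_edges_copy])
      _ ≤ k + m + T * (c + m) + c + m := by
          gcongr
          exacts [ih _ fun i => hC _, hC _]
      _ = k + m + (T + 1) * (c + m) := by ring

/-- The network `A` with a new first input `z`: the values `relu (α c * z + β c)` are computed by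
separate gates and enter every gate of the last layer with weight `-b`. -/
noncomputable def gate (hrelu : relu ∈ 𝒜) (hq : 0 < q) (α β : Fin q → ℝ) (b : ℝ)
    (A : Net 𝒜 (k + 2) n m) : Net 𝒜 (k + 2) (n + 1) m :=
  (A.addBranch hrelu (ofAffineLayer hrelu hq k (.full (fun c (_ : Fin 1) => α c) β))
    (.full (fun _ _ => -b) 0)).comap (Fin.append Fin.succ fun _ => 0)

lemma eval_gate (hrelu : relu ∈ 𝒜) (hq : 0 < q) (α β : Fin q → ℝ) (b : ℝ)
    (A : Net 𝒜 (k + 2) n m) (z : ℝ) (x : Fin n → ℝ) (j : Fin m) :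
    (A.gate hrelu hq α β b).eval (Fin.cons z x) j =
      relu (A.preoutput x j - b * ∑ c, relu (α c * z + β c)) := by
  have hx : (Fin.cons z x : Fin (n + 1) → ℝ) ∘ Fin.append Fin.succ (fun _ : Fin 1 => 0) =
      Fin.append x fun _ => z := by
    rw [comp_append]
    rfl
  rw [eval_apply, gate, preoutput_comap, hx, preoutput_addBranch]
  simp [sub_eq_add_neg, Finset.mul_sum]

lemma numParams_gate_le (hrelu : relu ∈ 𝒜) (hq : 0 < q) (α β : Fin q → ℝ) (b : ℝ)
    (A : Net 𝒜 (k + 2) n m) :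
    (A.gate hrelu hq α β b).numParams ≤ A.numParams + 2 * (k + 1) * q + m * q := by
  calc (A.gate hrelu hq α β b).numParams
      ≤ A.numParams + (q * 1 + q + k * (2 * q)) + m * q :=
        (numParams_comap_le _ _).trans <| (numParams_addBranch_le _ _ _ _).trans_eq (by
          simp [AffineLayer.numParams])
    _ = A.numParams + 2 * (k + 1) * q + m * q := by ring

end Net

section Classes

variable {𝒜 : Set (ℝ → ℝ)} {k N N' n d : ℕ}

lemma measurable_of_mem_generatorNets (h𝒜 : ∀ σ ∈ 𝒜, Measurable σ)
    {G : EuclideanSpace ℝ (Fin n) → EuclideanSpace ℝ (Fin d)}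
    (hG : G ∈ generatorNets 𝒜 k N n d) : Measurable G := by
  obtain ⟨A, -, hG⟩ := hG
  rw [funext hG]
  exact (WithLp.measurable_toLp 2 _).comp
    ((A.measurable_eval h𝒜).comp (WithLp.measurable_ofLp 2 _))

lemma exists_deeper_net (hrelu : relu ∈ 𝒜) {m : ℕ} (A : Net 𝒜 k n m)
    (hA : A.numParams ≤ N) (hN : 3 * N + 2 ≤ N') :
    ∃ B : Net 𝒜 (k + 1) n m, B.numParams ≤ N' ∧ B.eval = A.eval := by
  refine ⟨.sum hrelu ![A], ?_, by funext x; simp⟩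
  have := Net.numParams_sum_le hrelu ![A] (c := N) (by simpa using hA)
  have := A.depth_add_width_le
  omega

lemma ignoreFirst_mem_generatorNets (hrelu : relu ∈ 𝒜)
    {G : EuclideanSpace ℝ (Fin n) → EuclideanSpace ℝ (Fin d)}
    (hG : G ∈ generatorNets 𝒜 k N n d) (hN : 3 * N + 2 ≤ N') :
    ignoreFirst G ∈ generatorNets 𝒜 (k + 1) N' (n + 1) d := by
  obtain ⟨A, hA, hG⟩ := hG
  obtain ⟨B, hB, hBA⟩ := exists_deeper_net hrelu A hA hN
  refine ⟨B.comap Fin.succ, (B.numParams_comap_le _).trans hB, fun h => ?_⟩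
  rw [ignoreFirst, hG, Net.eval_comap, hBA]
  rfl

lemma discriminatorNets_subset_succ (hrelu : relu ∈ 𝒜) (hN : 3 * N + 2 ≤ N') :
    discriminatorNets 𝒜 k N d ⊆ discriminatorNets 𝒜 (k + 1) N' d := by
  rintro D ⟨⟨A, hA, hD⟩, hD01⟩
  obtain ⟨B, hB, hBA⟩ := exists_deeper_net hrelu A hA hN
  exact ⟨⟨B, hB, fun x => by rw [hD, hBA]⟩, hD01⟩

lemma const_mem_discriminatorNets (hrelu : relu ∈ 𝒜) {c : ℝ} (hc : c ∈ Icc 0 1) (hN : k + 1 ≤ N) :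
    (fun _ => c) ∈ discriminatorNets 𝒜 (k + 1) N d := by
  refine ⟨⟨.const hrelu k d fun _ => c, by simpa using hN, fun x => ?_⟩, fun _ => hc⟩
  simp [Net.eval_apply, relu_of_nonneg hc.1]

end Classes

lemma existsUnique_cut {α : Type*} [LinearOrder α] {T : ℕ} {q : ℕ → α}
    (hmono : MonotoneOn q (Iic T)) {z : α} (hne : ∀ i, z ≠ q i) (hbot : q 0 ≤ z)
    (htop : z ≤ q T) : ∃! i : Fin T, q i ≤ z ∧ z ≤ q (i + 1) := by
  have hT : T ≠ 0 := fun h => hne T (le_antisymm htop (h ▸ hbot))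
  obtain ⟨i, hi, hi'⟩ := Nat.exists_not_and_succ_of_not_zero_of_exists
    (p := fun n => T ≤ n ∨ z < q n) (by simp [hbot, hT]) ⟨T, .inl le_rfl⟩
  push Not at hi
  have hi' : z ≤ q (i + 1) :=
    hi'.elim (fun h => (show i + 1 = T by omega) ▸ htop) le_of_lt
  have hdisjoint : ∀ i j : Fin T, i < j → z ≤ q (i + 1) → ¬ q j ≤ z :=
    fun i j hij hi hj => hne j (le_antisymm (hi.trans (hmono i.2 j.2.le hij)) hj)
  refine ⟨⟨i, hi.1⟩, ⟨hi.2, hi'⟩, fun j hj => ?_⟩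
  exact le_antisymm (le_of_not_gt fun h => hdisjoint _ _ h hi' hj.1)
    (le_of_not_gt fun h => hdisjoint _ _ h hj.2 hi.2)

section Switches

lemma ae_coe_ne (ν : Measure ℝ) [NullSingletonClass ν] (q : EReal) :
    ∀ᵐ z : ℝ ∂ν, (z : EReal) ≠ q := by
  refine Set.Subsingleton.measure_zero (fun a ha b hb => ?_) ν
  simp only [ne_eq, mem_compl_iff, mem_ofPred_eq, not_not] at ha hb
  exact_mod_cast ha.trans hb.symm

variable (ν : Measure ℝ) [IsProbabilityMeasure ν] [NullSingletonClass ν]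

lemma continuous_cdf : Continuous (cdf ν) := by
  refine continuous_iff_continuousAt.2 fun x => ?_
  have hx : (cdf ν).measure {x} = 0 := by rw [measure_cdf, measure_singleton]
  rw [StieltjesFunction.measure_singleton, ENNReal.ofReal_eq_zero] at hx
  refine (cdf ν).mono.continuousAt_iff_leftLim_eq_rightLim.2 (le_antisymm ?_ ?_)
  · exact (cdf ν).mono.leftLim_le_rightLim le_rfl
  · rw [(cdf ν).rightLim_eq]
    linarith

lemma exists_quantile {c : ℝ} (hc : c ∈ Icc 0 1) :
    ∃ q : EReal, ν.real {z : ℝ | (z : EReal) < q} = c := by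
  obtain ⟨hc₀, hc₁⟩ := hc
  rcases hc₀.eq_or_lt with rfl | hc₀
  · exact ⟨⊥, by simp⟩
  rcases hc₁.eq_or_lt with rfl | hc₁
  · exact ⟨⊤, by simp [EReal.coe_lt_top]⟩
  obtain ⟨q, hq⟩ := mem_range_of_exists_le_of_exists_ge (continuous_cdf ν)
    (((tendsto_cdf_atBot ν).eventually_lt_const hc₀).exists.imp fun _ => le_of_lt)
    (((tendsto_cdf_atTop ν).eventually_const_lt hc₁).exists.imp fun _ => le_of_lt)
  refine ⟨q, ?_⟩
  rw [← hq, cdf_eq_real]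
  exact measureReal_congr (by simpa [Iio] using Iio_ae_eq_Iic)

lemma exists_monotone_quantiles {T : ℕ} (hT : 0 < T) :
    ∃ q : ℕ → EReal, MonotoneOn q (Iic T) ∧
      ∀ i ≤ T, ν.real {z : ℝ | (z : EReal) < q i} = i / T := by
  have hT₀ : (0 : ℝ) < T := by exact_mod_cast hT
  have hexists : ∀ i ≤ T, ∃ q : EReal, ν.real {z : ℝ | (z : EReal) < q} = i / T := fun i hi =>
    exists_quantile ν ⟨by positivity, (div_le_one hT₀).2 (by exact_mod_cast hi)⟩
  choose! q hq using hexists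
  refine ⟨q, fun i hi j hj hij => ?_, hq⟩
  rcases hij.eq_or_lt with rfl | hij
  · rfl
  by_contra! hlt
  have hle : ν.real {z : ℝ | (z : EReal) < q j} ≤ ν.real {z : ℝ | (z : EReal) < q i} :=
    measureReal_mono fun z hz => lt_trans hz hlt
  rw [hq j hj, hq i hi, div_le_div_iff_of_pos_right hT₀] at hle
  exact hij.not_ge (by exact_mod_cast hle)

lemma exists_uniform_cuts {T : ℕ} (hT : 0 < T) :
    ∃ q : ℕ → EReal,
      (∀ᵐ z : ℝ ∂ν, ∃! i : Fin T, q i ≤ z ∧ z ≤ q (i + 1)) ∧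
      ∀ i : Fin T, ν.real {z : ℝ | q i ≤ z ∧ z ≤ q (i + 1)} = 1 / T := by
  obtain ⟨q, hmono, hq⟩ := exists_monotone_quantiles ν hT
  have hmeas : ∀ i, MeasurableSet {z : ℝ | (z : EReal) < q i} := fun i =>
    measurableSet_lt measurable_coe_real_ereal measurable_const
  have hne : ∀ᵐ z : ℝ ∂ν, ∀ i, (z : EReal) ≠ q i := ae_all_iff.2 fun i => ae_coe_ne ν (q i)
  have hbot : ∀ᵐ z : ℝ ∂ν, q 0 ≤ z := by
    have h := hq 0 T.zero_le
    rw [Nat.cast_zero, zero_div, measureReal_eq_zero_iff] at h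
    simpa [ae_iff] using h
  have htop : ∀ᵐ z : ℝ ∂ν, z ≤ q T := by
    have h := hq T le_rfl
    rw [div_self (by exact_mod_cast hT.ne'), measureReal_def, ENNReal.toReal_eq_one_iff] at h
    filter_upwards [(mem_ae_iff_prob_eq_one (hmeas T)).2 h] with z hz using le_of_lt hz
  refine ⟨q, ?_, fun i => ?_⟩
  · filter_upwards [hne, hbot, htop] with z hne hbot htop
    exact existsUnique_cut hmono hne hbot htop
  · have hdiff : {z : ℝ | q i ≤ z ∧ z ≤ q (i + 1)} =ᵐ[ν]
        ({z : ℝ | (z : EReal) < q (i + 1)} \ {z : ℝ | (z : EReal) < q i} : Set ℝ) := by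
      refine Filter.eventuallyEq_set.2 (hne.mono fun z hz => ?_)
      exact ⟨fun h => ⟨h.2.lt_of_ne (hz _), h.1.not_gt⟩, fun h => ⟨le_of_not_gt h.2, h.1.le⟩⟩
    rw [measureReal_congr hdiff, measureReal_sdiff _ (hmeas i), hq _ i.2, hq _ i.2.le]
    · push_cast
      ring
    · exact fun z hz => lt_of_lt_of_le hz (hmono i.2.le i.2 (Nat.le_succ _))

end Switches

lemma exists_relu_eq_zero_iff_ge (q : EReal) :
    ∃ a b : ℝ, ∀ z : ℝ, relu (a * z + b) = 0 ↔ q ≤ z := by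
  induction q with
  | bot => exact ⟨0, 0, by simp [relu]⟩
  | top => exact ⟨0, 1, by simp [relu]⟩
  | coe q => exact ⟨-1, q, fun z => by simp [relu_eq_zero_iff]⟩

lemma exists_relu_eq_zero_iff_le (q : EReal) :
    ∃ a b : ℝ, ∀ z : ℝ, relu (a * z + b) = 0 ↔ z ≤ q := by
  obtain ⟨a, b, h⟩ := exists_relu_eq_zero_iff_ge (-q)
  exact ⟨-a, b, fun z => by simpa [EReal.neg_le_neg_iff] using h (-z)⟩

lemma exists_uniform_switches (ν : Measure ℝ) [IsProbabilityMeasure ν] [NullSingletonClass ν]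
    {T : ℕ} (hT : 0 < T) :
    ∃ α β : Fin T → Fin 2 → ℝ,
      (∀ᵐ z ∂ν, ∃! i, ∑ c, relu (α i c * z + β i c) = 0) ∧
      ∀ i, ν.real {z | ∑ c, relu (α i c * z + β i c) = 0} = 1 / T := by
  obtain ⟨q, hunique, hmass⟩ := exists_uniform_cuts ν hT
  choose a b hge using exists_relu_eq_zero_iff_ge
  choose a' b' hle using exists_relu_eq_zero_iff_le
  have hsum : ∀ (i : Fin T) (z : ℝ), ∑ c, relu (![a (q i), a' (q (i + 1))] c * z +
      ![b (q i), b' (q (i + 1))] c) = 0 ↔ q i ≤ z ∧ z ≤ q (i + 1) := fun i z => by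
    rw [Finset.sum_eq_zero_iff_of_nonneg fun _ _ => relu_nonneg _]
    simp [hge, hle]
  exact ⟨fun i => ![a (q i), a' (q (i + 1))], fun i => ![b (q i), b' (q (i + 1))],
    by simpa only [hsum] using hunique, by simpa only [hsum] using hmass⟩

section Mixture

lemma eventually_sum_relu_sub_eq {ι : Type*} [Fintype ι] {s : ι → ℝ} (hs : ∀ i, 0 ≤ s i) {i₀ : ι}
    (hi₀ : s i₀ = 0) (hunique : ∀ i, s i = 0 → i = i₀) (y : ι → ℝ) :
    ∀ᶠ n : ℕ in Filter.atTop, ∑ i, relu (y i - n * s i) = relu (y i₀) := by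
  have hoff : ∀ᶠ n : ℕ in Filter.atTop, ∀ i, i ≠ i₀ → y i ≤ n * s i := by
    refine Filter.eventually_all.2 fun i => Filter.eventually_imp_distrib_left.2 fun hi => ?_
    have hpos : 0 < s i := (hs i).lt_of_ne' fun h => hi (hunique i h)
    exact (tendsto_natCast_atTop_atTop.atTop_mul_const hpos).eventually_ge_atTop _
  filter_upwards [hoff] with n hn
  rw [Fintype.sum_eq_single i₀ fun i hi => relu_of_nonpos (sub_nonpos.2 (hn i hi)), hi₀, mul_zero,
    sub_zero]

lemma integral_mixture {Ω Ω' ι : Type*} [MeasurableSpace Ω] [MeasurableSpace Ω'] [Fintype ι]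
    (ν : Measure Ω) [IsFiniteMeasure ν] (γ : Measure Ω') [SFinite γ] {W : ι → Set Ω}
    (hW : ∀ i, MeasurableSet (W i)) {f : ι → Ω' → ℝ} (hf : ∀ i, Integrable (f i) γ) :
    ∫ ω, ∑ i, (W i).indicator (fun _ => 1) ω.1 * f i ω.2 ∂ν.prod γ =
      ∑ i, ν.real (W i) * ∫ h, f i h ∂γ := by
  rw [integral_finsetSum _ fun i _ =>
    ((integrable_const (1 : ℝ)).indicator (hW i)).mul_prod (hf i)]
  refine Finset.sum_congr rfl fun i _ => ?_
  rw [integral_prod_mul, integral_indicator_const _ (hW i), smul_eq_mul, mul_one]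

/-- The vector with first coordinate `z`, followed by the coordinates of `h`. -/
noncomputable def consVec {n : ℕ} (z : ℝ) (h : EuclideanSpace ℝ (Fin n)) :
    EuclideanSpace ℝ (Fin (n + 1)) :=
  WithLp.toLp 2 (Fin.cons z (WithLp.ofLp h))

lemma measurePreserving_consVec (n : ℕ) :
    MeasurePreserving (fun q : ℝ × EuclideanSpace ℝ (Fin n) => consVec q.1 q.2)
      ((gaussianReal 0 1).prod (stdGaussian (EuclideanSpace ℝ (Fin n))))
      (stdGaussian (EuclideanSpace ℝ (Fin (n + 1)))) := by
  have hto : ∀ m : ℕ, MeasurePreserving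
      (MeasurableEquiv.toLp 2 (Fin m → ℝ)) (Measure.pi fun _ => gaussianReal 0 1)
      (stdGaussian (EuclideanSpace ℝ (Fin m))) := fun m =>
    ⟨(MeasurableEquiv.toLp 2 (Fin m → ℝ)).measurable, map_pi_eq_stdGaussian⟩
  convert (hto (n + 1)).comp (((measurePreserving_piFinSuccAbove
    (fun _ : Fin (n + 1) => gaussianReal 0 1) 0).symm _).comp
      ((MeasurePreserving.id (gaussianReal 0 1)).prod ((hto n).symm _))) using 1
  funext q
  ext i
  cases i using Fin.cases <;> rfl

lemma integral_generatedLaw {n d : ℕ} {G : EuclideanSpace ℝ (Fin n) → EuclideanSpace ℝ (Fin d)}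
    (hG : Measurable G) {f : EuclideanSpace ℝ (Fin d) → ℝ} (hf : Measurable f) :
    ∫ x, f x ∂generatedLaw G = ∫ h, f (G h) ∂stdGaussian (EuclideanSpace ℝ (Fin n)) :=
  integral_map hG.aemeasurable hf.aestronglyMeasurable

lemma tendsto_integral_gated {ι : Type*} [Fintype ι] {l d : ℕ} {s : ι → ℝ → ℝ}
    (hs : ∀ i, Measurable (s i)) (hs_nonneg : ∀ i z, 0 ≤ s i z)
    (hunique : ∀ᵐ z ∂gaussianReal 0 1, ∃! i, s i z = 0)
    {y : ι → EuclideanSpace ℝ (Fin l) → Fin d → ℝ}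
    {G : ι → EuclideanSpace ℝ (Fin l) → EuclideanSpace ℝ (Fin d)}
    (hG : ∀ i, Measurable (G i)) (hGy : ∀ i h j, G i h j = relu (y i h j))
    {S : ℕ → EuclideanSpace ℝ (Fin (l + 1)) → EuclideanSpace ℝ (Fin d)}
    (hS : ∀ n, Measurable (S n))
    (hSy : ∀ n z h j, S n (consVec z h) j = ∑ i, relu (y i h j - n * s i z))
    {f : EuclideanSpace ℝ (Fin d) → ℝ} (hf : Measurable f) {b : ℝ} (hfb : ∀ x, |f x| ≤ b) :
    Filter.Tendsto (fun n => ∫ x, f x ∂generatedLaw (S n)) Filter.atTop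
      (nhds (∑ i, (gaussianReal 0 1).real {z | s i z = 0} * ∫ x, f x ∂generatedLaw (G i))) := by
  have hcons := measurePreserving_consVec l
  have hW : ∀ i, MeasurableSet {z | s i z = 0} := fun i => hs i (measurableSet_singleton 0)
  have hint : ∀ i, Integrable (fun h => f (G i h)) (stdGaussian (EuclideanSpace ℝ (Fin l))) :=
    fun i => .of_bound (hf.comp (hG i)).aestronglyMeasurable b (ae_of_all _ fun h => hfb _)
  have hsplit : ∀ n, ∫ x, f x ∂generatedLaw (S n) = ∫ q, f (S n (consVec q.1 q.2))
      ∂(gaussianReal 0 1).prod (stdGaussian (EuclideanSpace ℝ (Fin l))) := fun n => by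
    rw [integral_generatedLaw (hS n) hf, ← hcons.map_eq]
    exact integral_map hcons.aemeasurable (hf.comp (hS n)).aestronglyMeasurable
  simp_rw [hsplit, integral_generatedLaw (hG _) hf]
  rw [← integral_mixture _ _ hW hint]
  refine tendsto_integral_of_dominated_convergence (fun _ => b)
    (fun n => ((hf.comp (hS n)).comp hcons.measurable).aestronglyMeasurable)
    (integrable_const b) (fun n => ae_of_all _ fun q => hfb _) ?_
  filter_upwards [Measure.quasiMeasurePreserving_fst.ae hunique] with ⟨z, h⟩ ⟨i₀, hi₀, hi₀_unique⟩
  have hlimit : ∑ i, {z | s i z = 0}.indicator (fun _ => 1) z * f (G i h) = f (G i₀ h) := by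
    rw [Fintype.sum_eq_single i₀ fun i hi => ?_]
    · simp [indicator, hi₀]
    · simp [indicator, mt (hi₀_unique i) hi]
  have heventually : ∀ᶠ n in Filter.atTop, S n (consVec z h) = G i₀ h := by
    have hcoord := Filter.eventually_all.2 fun j =>
      eventually_sum_relu_sub_eq (fun i => hs_nonneg i z) hi₀ hi₀_unique fun i => y i h j
    filter_upwards [hcoord] with n hn
    ext j
    rw [hSy, hGy, hn]
  rw [hlimit]
  exact tendsto_const_nhds.congr' (heventually.mono fun n hn => (congrArg f hn).symm)

end Mixture

section Sampling

lemma measureReal_pi_sum_sub_integral_ge_le {X : Type*} [MeasurableSpace X] (μ : Measure X)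
    [IsProbabilityMeasure μ] {f : X → ℝ} (hf : AEMeasurable f μ) {a b : ℝ}
    (hfab : ∀ᵐ x ∂μ, f x ∈ Icc a b) (T : ℕ) {τ : ℝ} (hτ : 0 ≤ τ) :
    (Measure.pi fun _ : Fin T => μ).real {x | T * τ ≤ ∑ i, (f (x i) - ∫ y, f y ∂μ)} ≤
      Real.exp (-(2 * T * τ ^ 2 / (b - a) ^ 2)) := by
  have hindep : iIndepFun (fun i (x : Fin T → X) => f (x i) - ∫ y, f y ∂μ)
      (Measure.pi fun _ => μ) :=
    iIndepFun_pi (X := fun (_ : Fin T) (y : X) => f y - ∫ y, f y ∂μ) fun _ => hf.sub_const _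
  have hsub : ∀ i ∈ Finset.univ, HasSubgaussianMGF
      (fun x : Fin T → X => f (x i) - ∫ y, f y ∂μ) ((‖b - a‖₊ / 2) ^ 2)
      (Measure.pi fun _ => μ) := fun i _ => by
    refine .of_map (X := fun y => f y - ∫ y, f y ∂μ) (measurable_pi_apply i).aemeasurable ?_
    rw [(measurePreserving_eval (fun _ : Fin T => μ) i).map_eq]
    exact hasSubgaussianMGF_of_mem_Icc hf hfab
  refine (HasSubgaussianMGF.measure_sum_ge_le_of_iIndepFun hindep hsub (by positivity)).trans_eq ?_
  rcases eq_or_ne (T : ℝ) 0 with hT | hT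
  · simp [hT]
  · simp only [Finset.sum_const, Finset.card_univ, Fintype.card_fin, nsmul_eq_mul]
    push_cast
    rw [div_pow, Real.norm_eq_abs, sq_abs]
    field_simp [hT]

lemma exists_sample_sum_le {X ι : Type*} [MeasurableSpace X] (μ : Measure X)
    [IsProbabilityMeasure μ] (S : Finset ι) {f : ι → X → ℝ} (hf : ∀ s ∈ S, AEMeasurable (f s) μ)
    {a b : ℝ} (hfab : ∀ s ∈ S, ∀ᵐ x ∂μ, f s x ∈ Icc a b) {P : X → Prop} (hP : ∀ᵐ x ∂μ, P x)
    {T : ℕ} {τ : ℝ} (hτ : 0 ≤ τ)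
    (hS : S.card * Real.exp (-(2 * T * τ ^ 2 / (b - a) ^ 2)) < 1) :
    ∃ x : Fin T → X, (∀ i, P (x i)) ∧ ∀ s ∈ S, ∑ i, f s (x i) ≤ T * (∫ y, f s y ∂μ + τ) := by
  set ν : Measure (Fin T → X) := Measure.pi fun _ => μ
  let bad : ι → Set (Fin T → X) := fun s =>
    {x | T * τ ≤ ∑ i, (f s (x i) - ∫ y, f s y ∂μ)}
  have hbad : ν.real (⋃ s ∈ S, bad s) < 1 := by
    refine ((measureReal_biUnion_finset_le S bad).trans (Finset.sum_le_sum fun s hs =>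
      measureReal_pi_sum_sub_integral_ge_le μ (hf s hs) (hfab s hs) T hτ)).trans_lt ?_
    rwa [Finset.sum_const, nsmul_eq_mul]
  have hgood : ∃ᵐ x ∂ν, x ∉ ⋃ s ∈ S, bad s := fun h => by
    have hmem : ⋃ s ∈ S, bad s ∈ ae ν := h.mono fun x => not_not.1
    rw [measureReal_congr (Filter.eventuallyEq_univ.2 hmem), probReal_univ] at hbad
    exact hbad.false
  have hPν : ∀ᵐ x ∂ν, ∀ i, P (x i) :=
    ae_all_iff.2 fun i => (Measure.quasiMeasurePreserving_eval (fun _ : Fin T => μ) i).ae hP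
  obtain ⟨x, hx, hxP⟩ := (hgood.and_eventually hPν).exists
  refine ⟨x, hxP, fun s hs => ?_⟩
  have hxs : ∑ i, (f s (x i) - ∫ y, f s y ∂μ) < T * τ := not_le.1 fun h => hx (mem_biUnion hs h)
  simp only [Finset.sum_sub_distrib, Finset.sum_const, Finset.card_univ, Fintype.card_fin,
    nsmul_eq_mul] at hxs
  linarith

end Sampling

section Covering

open Metric Module
open scoped NNReal

variable {E : Type*} [NormedAddCommGroup E] [NormedSpace ℝ E] [FiniteDimensional ℝ E]

lemma card_le_of_isSeparated {S : Finset E} {x : E} {R : ℝ} (hR : 0 ≤ R) {r : ℝ≥0} (hr : 0 < r)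
    (hS : (S : Set E) ⊆ closedBall x R) (hsep : IsSeparated r (S : Set E)) :
    (S.card : ℝ) ≤ (1 + 2 * R / r) ^ finrank ℝ E := by
  borelize E
  let ν : Measure E := Measure.addHaar
  have hr' : (0 : ℝ) < r / 2 := by positivity
  have hvol : ∀ y {ρ : ℝ}, 0 < ρ → ν.real (ball y ρ) = ρ ^ finrank ℝ E * ν.real (ball 0 1) := by
    intro y ρ hρ
    rw [measureReal_def, ν.addHaar_ball_of_pos y hρ, ENNReal.toReal_mul,
      ENNReal.toReal_ofReal (by positivity), measureReal_def]
  have hdisj : (S : Set E).PairwiseDisjoint fun s => ball s (r / 2) := fun s hs t ht hst =>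
    ball_disjoint_ball <| by
      have hdist : (r : ENNReal) < edist s t := hsep hs ht hst
      rw [edist_nndist, ENNReal.coe_lt_coe] at hdist
      rw [add_halves, dist_nndist]
      exact_mod_cast hdist.le
  have hsub : ⋃ s ∈ S, ball s (r / 2) ⊆ ball x (R + r / 2) := iUnion₂_subset fun s hs =>
    ball_subset_ball' (by linarith [mem_closedBall.1 (hS hs)])
  have hle : S.card * (r / 2 : ℝ) ^ finrank ℝ E ≤ (R + r / 2) ^ finrank ℝ E := by
    refine le_of_mul_le_mul_right ?_
      (ENNReal.toReal_pos (measure_ball_pos ν 0 one_pos).ne' measure_ball_lt_top.ne)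
    calc S.card * (r / 2 : ℝ) ^ finrank ℝ E * ν.real (ball 0 1)
        = ν.real (⋃ s ∈ S, ball s (r / 2)) := by
          rw [measureReal_biUnion_finset hdisj (fun _ _ => measurableSet_ball)
            (fun _ _ => measure_ball_lt_top.ne), Finset.sum_congr rfl fun s _ => hvol s hr',
            Finset.sum_const, nsmul_eq_mul, mul_assoc]
      _ ≤ ν.real (ball x (R + r / 2)) := measureReal_mono hsub measure_ball_lt_top.ne
      _ = (R + r / 2) ^ finrank ℝ E * ν.real (ball 0 1) := hvol x (by positivity)
  have hquot : 1 + 2 * R / r = (R + r / 2) / (r / 2 : ℝ) := by field_simp; ring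
  rwa [hquot, div_pow, le_div_iff₀ (by positivity)]

lemma packingNumber_le {A : Set E} {x : E} {R : ℝ} (hR : 0 ≤ R) (hA : A ⊆ closedBall x R)
    {r : ℝ≥0} (hr : 0 < r) :
    packingNumber r A ≤ ⌊(1 + 2 * R / r : ℝ) ^ finrank ℝ E⌋₊ := by
  refine iSup_le fun C => iSup_le fun hCA => iSup_le fun hC => not_lt.1 fun hlt => ?_
  obtain ⟨C', hsub, hC'⟩ := exists_subset_encard_eq (Order.add_one_le_of_lt hlt)
  have hfin : C'.Finite := finite_of_encard_eq_coe (by exact_mod_cast hC')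
  have hcard := card_le_of_isSeparated (S := hfin.toFinset) hR hr
    (by rw [hfin.coe_toFinset]; exact hsub.trans (hCA.trans hA))
    (by rw [hfin.coe_toFinset]; exact hC.subset hsub)
  rw [hfin.encard_eq_coe_toFinset_card] at hC'
  have hcard' : hfin.toFinset.card = ⌊(1 + 2 * R / r : ℝ) ^ finrank ℝ E⌋₊ + 1 := by
    exact_mod_cast hC'
  exact (Nat.le_floor hcard).not_gt (hcard' ▸ Nat.lt_succ_self _)

lemma exists_finset_cover {A : Set E} {x : E} {R : ℝ} (hR : 0 ≤ R) (hA : A ⊆ closedBall x R)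
    {r : ℝ} (hr : 0 < r) :
    ∃ S : Finset E, (S : Set E) ⊆ A ∧ (∀ v ∈ A, ∃ s ∈ S, dist v s ≤ r) ∧
      (S.card : ℝ) ≤ (1 + 2 * R / r) ^ finrank ℝ E := by
  lift r to ℝ≥0 using hr.le
  have hpack := packingNumber_le hR hA (by exact_mod_cast hr : 0 < r)
  have hne : packingNumber r A ≠ ⊤ := (hpack.trans_lt (ENat.natCast_lt_top _)).ne
  rw [← encard_maximalSeparatedSet hne] at hpack
  have hfin := finite_of_encard_le_coe hpack
  have hcover := isCover_iff_subset_iUnion_closedBall.1 (isCover_maximalSeparatedSet hne)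
  refine ⟨hfin.toFinset, ?_, fun v hv => ?_, ?_⟩
  · rw [hfin.coe_toFinset]
    exact maximalSeparatedSet_subset
  · obtain ⟨s, hs, hvs⟩ := mem_iUnion₂.1 (hcover hv)
    exact ⟨s, hfin.mem_toFinset.2 hs, hvs⟩
  · rw [hfin.encard_eq_coe_toFinset_card] at hpack
    exact (Nat.le_floor_iff (by positivity)).1 (by exact_mod_cast hpack)

end Covering

section PointMass

lemma exists_le_add_mul_dist {X : Type*} [PseudoMetricSpace X] {f : X → ℝ} {a b : ℝ}
    (hfab : ∀ y, f y ∈ Icc a b) {x : X} (hf : ContinuousAt f x) {δ : ℝ} (hδ : 0 < δ) :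
    ∃ C : ℝ, ∀ y, f y ≤ f x + δ + C * dist y x := by
  obtain ⟨r, hr, hclose⟩ := Metric.continuousAt_iff.1 hf δ hδ
  have hab : 0 ≤ b - a := sub_nonneg.2 ((hfab x).1.trans (hfab x).2)
  refine ⟨(b - a) / r, fun y => ?_⟩
  rcases lt_or_ge (dist y x) r with hy | hy
  · have hlt := (le_abs_self _).trans_lt (hclose hy)
    have hnonneg : 0 ≤ (b - a) / r * dist y x := by positivity
    linarith
  · have hfar : b - a ≤ (b - a) / r * dist y x := by
      rw [div_mul_eq_mul_div, le_div_iff₀ hr]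
      gcongr
    linarith [(hfab x).1, (hfab y).2]

lemma eventually_integral_comp_le {Ω E : Type*} [MeasurableSpace Ω] (ν : Measure Ω)
    [IsProbabilityMeasure ν] [NormedAddCommGroup E] {f : E → ℝ} (hf : Continuous f) {a b : ℝ}
    (hfab : ∀ y, f y ∈ Icc a b) (x : E) {δ : ℝ} (hδ : 0 < δ) :
    ∀ᶠ η in nhdsWithin 0 (Ioi (0 : ℝ)), ∀ X : Ω → E, Integrable X ν →
      ∫ ω, ‖X ω - x‖ ∂ν ≤ η → ∫ ω, f (X ω) ∂ν ≤ f x + δ := by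
  obtain ⟨C, hC⟩ := exists_le_add_mul_dist hfab hf.continuousAt (half_pos hδ)
  have hsmall : ∀ᶠ η in nhds (0 : ℝ), |C| * η < δ / 2 :=
    (by fun_prop : Continuous fun η => |C| * η).tendsto' 0 0 (mul_zero _)
      |>.eventually_lt_const (half_pos hδ)
  filter_upwards [hsmall.filter_mono nhdsWithin_le_nhds] with η hη X hX hXη
  have hdist : Integrable (fun ω => ‖X ω - x‖) ν := (hX.sub (integrable_const x)).norm
  calc ∫ ω, f (X ω) ∂ν
      ≤ ∫ ω, (f x + δ / 2 + |C| * ‖X ω - x‖) ∂ν := by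
        refine integral_mono ?_ ((integrable_const _).add (hdist.const_mul _)) fun ω => ?_
        · exact .of_mem_Icc a b (hf.comp_aestronglyMeasurable hX.1).aemeasurable
            (ae_of_all _ fun ω => hfab _)
        · refine (hC (X ω)).trans ?_
          rw [dist_eq_norm]
          gcongr
          exact le_abs_self C
    _ = f x + δ / 2 + |C| * ∫ ω, ‖X ω - x‖ ∂ν := by
        rw [integral_add (integrable_const _) (hdist.const_mul _), integral_const,
          probReal_univ, one_smul, integral_const_mul]
    _ ≤ f x + δ / 2 + |C| * η := by gcongr
    _ ≤ f x + δ := by linarith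

end PointMass

section Generators

variable {𝒜 : Set (ℝ → ℝ)} {k p l d T : ℕ}

lemma Net.numParams_sum_gate_le (hrelu : relu ∈ 𝒜) (hT : 0 < T) {A : Fin T → Net 𝒜 (k + 2) l d}
    (hA : ∀ i, (A i).numParams ≤ p) (α β : Fin T → Fin 2 → ℝ) (b : ℝ) :
    (Net.sum hrelu fun i => (A i).gate hrelu two_pos (α i) (β i) b).numParams ≤ 7 * T * p := by
  have hkd := (A ⟨0, hT⟩).depth_add_width_le
  have hAp := hA ⟨0, hT⟩
  calc (Net.sum hrelu fun i => (A i).gate hrelu two_pos (α i) (β i) b).numParams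
      ≤ k + 2 + d + T * (p + 2 * (k + 1) * 2 + d * 2 + d) :=
        numParams_sum_le hrelu _ fun i => (numParams_gate_le ..).trans (by gcongr; exact hA i)
    _ ≤ T * (2 * p) + T * (5 * p) := by
        gcongr
        · exact le_mul_of_one_le_of_le hT (by omega)
        · omega
    _ = 7 * T * p := by ring

lemma exists_generatorNets_tendsto_mixture (hrelu : relu ∈ 𝒜) (h𝒜 : ∀ σ ∈ 𝒜, Measurable σ)
    (hT : 0 < T) {G : Fin T → EuclideanSpace ℝ (Fin l) → EuclideanSpace ℝ (Fin d)}
    (hG : ∀ i, G i ∈ generatorNets 𝒜 (k + 2) p l d) :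
    ∃ S : ℕ → EuclideanSpace ℝ (Fin (l + 1)) → EuclideanSpace ℝ (Fin d),
      (∀ n, S n ∈ generatorNets 𝒜 (k + 3) (7 * T * p) (l + 1) d) ∧
      ∀ (f : EuclideanSpace ℝ (Fin d) → ℝ) (b : ℝ), Measurable f → (∀ x, |f x| ≤ b) →
        Filter.Tendsto (fun n => ∫ x, f x ∂generatedLaw (S n)) Filter.atTop
          (nhds (1 / T * ∑ i, ∫ x, f x ∂generatedLaw (G i))) := by
  choose A hA hGA using hG
  have := nullSingletonClass_gaussianReal (μ := 0) one_ne_zero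
  obtain ⟨α, β, hunique, hmass⟩ := exists_uniform_switches (gaussianReal 0 1) hT
  let B : ℕ → Net 𝒜 (k + 3) (l + 1) d := fun n =>
    .sum hrelu fun i => (A i).gate hrelu two_pos (α i) (β i) n
  let S : ℕ → EuclideanSpace ℝ (Fin (l + 1)) → EuclideanSpace ℝ (Fin d) :=
    fun n h => WithLp.toLp 2 ((B n).eval (WithLp.ofLp h))
  have hS : ∀ n, S n ∈ generatorNets 𝒜 (k + 3) (7 * T * p) (l + 1) d :=
    fun n => ⟨B n, Net.numParams_sum_gate_le hrelu hT hA _ _ _, fun _ => rfl⟩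
  refine ⟨S, hS, fun f b hf hfb => ?_⟩
  have htendsto := tendsto_integral_gated (s := fun i z => ∑ c, relu (α i c * z + β i c))
    (fun i => Finset.measurable_sum _ fun c _ => measurable_relu.comp (by fun_prop))
    (fun i z => Finset.sum_nonneg fun c _ => relu_nonneg _) hunique
    (y := fun i h => (A i).preoutput (WithLp.ofLp h))
    (fun i => measurable_of_mem_generatorNets h𝒜 ⟨A i, hA i, hGA i⟩)
    (fun i h j => by rw [hGA]; exact (A i).eval_apply _ _)
    (fun n => measurable_of_mem_generatorNets h𝒜 (hS n))
    (fun n z h j => by simp [S, B, consVec, Net.eval_gate]) hf hfb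
  simpa only [hmass, Finset.mul_sum] using htendsto

variable {μ : Measure (EuclideanSpace ℝ (Fin d))} [IsProbabilityMeasure μ]
  {𝒢 : Set (EuclideanSpace ℝ (Fin l) → EuclideanSpace ℝ (Fin d))}

lemma exists_generator_integral_le (hrelu : relu ∈ 𝒜) (h𝒜 : ∀ σ ∈ 𝒜, Measurable σ)
    (h𝒢 : 𝒢 ⊆ generatorNets 𝒜 (k + 2) p l d) (hint : ∀ G ∈ 𝒢, Integrable G (stdGaussian _))
    (happrox : ∀ᵐ x ∂μ, ∀ η : ℝ, 0 < η → ∃ G ∈ 𝒢, ∫ h, ‖G h - x‖ ∂stdGaussian _ ≤ η)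
    {ι : Type*} (S : Finset ι) {f : ι → EuclideanSpace ℝ (Fin d) → ℝ}
    (hf : ∀ s ∈ S, Continuous (f s)) {a b : ℝ} (hfab : ∀ s ∈ S, ∀ x, f s x ∈ Icc a b)
    (hT : 0 < T) {τ δ : ℝ} (hτ : 0 ≤ τ) (hδ : 0 < δ)
    (hS : S.card * Real.exp (-(2 * T * τ ^ 2 / (b - a) ^ 2)) < 1) :
    ∃ G₀ ∈ generatorNets 𝒜 (k + 3) (7 * T * p) (l + 1) d,
      ∀ s ∈ S, ∫ x, f s x ∂generatedLaw G₀ ≤ ∫ x, f s x ∂μ + τ + 2 * δ := by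
  obtain ⟨x, hx, hsample⟩ := exists_sample_sum_le μ S
    (fun s hs => (hf s hs).measurable.aemeasurable) (fun s hs => ae_of_all _ (hfab s hs))
    happrox hτ hS
  have hpoint : ∀ i, ∃ G ∈ 𝒢, ∀ s ∈ S, ∫ y, f s y ∂generatedLaw G ≤ f s (x i) + δ := fun i => by
    have hsmall := (Finset.eventually_all S).2 fun s hs => eventually_integral_comp_le
      (stdGaussian (EuclideanSpace ℝ (Fin l))) (hf s hs) (hfab s hs) (x i) hδ
    obtain ⟨η, hη, hη₀⟩ := (hsmall.and self_mem_nhdsWithin).exists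
    obtain ⟨G, hG, hGx⟩ := hx i η hη₀
    refine ⟨G, hG, fun s hs => ?_⟩
    rw [integral_generatedLaw (measurable_of_mem_generatorNets h𝒜 (h𝒢 hG)) (hf s hs).measurable]
    exact hη s hs G (hint G hG) hGx
  choose G hG hGx using hpoint
  obtain ⟨G', hG', htendsto⟩ :=
    exists_generatorNets_tendsto_mixture hrelu h𝒜 hT fun i => h𝒢 (hG i)
  have hmix : ∀ s ∈ S, 1 / T * ∑ i, ∫ y, f s y ∂generatedLaw (G i) <
      ∫ y, f s y ∂μ + τ + 2 * δ := fun s hs => by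
    have hT' : (0 : ℝ) < T := by exact_mod_cast hT
    have hsum : ∑ i, ∫ y, f s y ∂generatedLaw (G i) ≤ T * (∫ y, f s y ∂μ + τ) + T * δ := by
      refine (Finset.sum_le_sum fun i _ => hGx i s hs).trans ?_
      simpa [Finset.sum_add_distrib] using hsample s hs
    rw [one_div_mul_eq_div, div_lt_iff₀ hT']
    nlinarith
  have heventually := (Finset.eventually_all S).2 fun s hs =>
    (htendsto (f s) (max |a| |b|) (hf s hs).measurable
      fun y => abs_le_max_abs_abs (hfab s hs y).1 (hfab s hs y).2).eventually_le_const (hmix s hs)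
  obtain ⟨n, hn⟩ := heventually.exists
  exact ⟨G' n, hG' n, hn⟩

end Generators

section Discriminators

lemma integral_le_integral_add_const {X : Type*} [MeasurableSpace X] (ν : Measure X)
    [IsProbabilityMeasure ν] {f g : X → ℝ} (hf : Integrable f ν) (hg : Integrable g ν) {δ : ℝ}
    (hfg : ∀ x, f x ≤ g x + δ) : ∫ x, f x ∂ν ≤ ∫ x, g x ∂ν + δ := by
  calc ∫ x, f x ∂ν ≤ ∫ x, (g x + δ) ∂ν := integral_mono hf (hg.add (integrable_const δ)) hfg
    _ = ∫ x, g x ∂ν + δ := by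
      rw [integral_add hg (integrable_const δ), integral_const, probReal_univ, one_smul]

variable {𝒜 : Set (ℝ → ℝ)} {k p l d T : ℕ} {μ : Measure (EuclideanSpace ℝ (Fin d))}
  [IsProbabilityMeasure μ] {𝒢 : Set (EuclideanSpace ℝ (Fin l) → EuclideanSpace ℝ (Fin d))}

lemma exists_generator_forall_integral_le (hrelu : relu ∈ 𝒜) (h𝒜 : ∀ σ ∈ 𝒜, Measurable σ)
    (h𝒢 : 𝒢 ⊆ generatorNets 𝒜 (k + 2) p l d) (hint : ∀ G ∈ 𝒢, Integrable G (stdGaussian _))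
    (happrox : ∀ᵐ x ∂μ, ∀ η : ℝ, 0 < η → ∃ G ∈ 𝒢, ∫ h, ‖G h - x‖ ∂stdGaussian _ ≤ η)
    {F : Type*} [NormedAddCommGroup F] [NormedSpace ℝ F] [FiniteDimensional ℝ F] {V : Set F}
    (hV : V ⊆ Metric.closedBall 0 1) {f : F → EuclideanSpace ℝ (Fin d) → ℝ}
    (hf : ∀ v ∈ V, Continuous (f v)) {a b : ℝ} (hfab : ∀ v ∈ V, ∀ x, f v x ∈ Icc a b)
    {K : NNReal} (hfK : ∀ x, LipschitzOnWith K (fun v => f v x) V)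
    (hT : 0 < T) {τ δ r : ℝ} (hτ : 0 ≤ τ) (hδ : 0 < δ) (hr : 0 < r) (hKr : K * r ≤ δ)
    (hexp : (1 + 2 / r) ^ Module.finrank ℝ F *
      Real.exp (-(2 * T * τ ^ 2 / (b - a) ^ 2)) < 1) :
    ∃ G₀ ∈ generatorNets 𝒜 (k + 3) (7 * T * p) (l + 1) d,
      ∀ v ∈ V, ∫ x, f v x ∂generatedLaw G₀ ≤ ∫ x, f v x ∂μ + τ + 4 * δ := by
  obtain ⟨S, hSV, hcover, hcard⟩ := exists_finset_cover zero_le_one hV hr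
  obtain ⟨G₀, hG₀, hle⟩ := exists_generator_integral_le hrelu h𝒜 h𝒢 hint happrox S
    (fun s hs => hf s (hSV hs)) (fun s hs => hfab s (hSV hs)) hT hτ hδ <|
      lt_of_le_of_lt (by gcongr; simpa using hcard) hexp
  have hG₀m := (measurable_of_mem_generatorNets h𝒜 hG₀).aemeasurable (μ := stdGaussian _)
  have : IsProbabilityMeasure (generatedLaw G₀) := Measure.isProbabilityMeasure_map hG₀m
  have hintegrable : ∀ v ∈ V, ∀ (ν : Measure (EuclideanSpace ℝ (Fin d))) [IsProbabilityMeasure ν],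
      Integrable (f v) ν := fun v hv ν _ =>
    .of_mem_Icc a b (hf v hv).measurable.aemeasurable (ae_of_all _ (hfab v hv))
  refine ⟨G₀, hG₀, fun v hv => ?_⟩
  obtain ⟨s, hs, hvs⟩ := hcover v hv
  have hclose : ∀ x, |f v x - f s x| ≤ δ := fun x =>
    ((hfK x).dist_le_mul v hv s (hSV hs)).trans (le_trans (by gcongr) hKr)
  calc ∫ x, f v x ∂generatedLaw G₀
      ≤ ∫ x, f s x ∂generatedLaw G₀ + δ :=
        integral_le_integral_add_const _ (hintegrable v hv _) (hintegrable s (hSV hs) _)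
          fun x => sub_le_iff_le_add'.1 (abs_le.1 (hclose x)).2
    _ ≤ ∫ x, f s x ∂μ + τ + 2 * δ + δ := by gcongr; exact hle s hs
    _ ≤ (∫ x, f v x ∂μ + δ) + τ + 2 * δ + δ := by
        gcongr
        exact integral_le_integral_add_const _ (hintegrable s (hSV hs) _) (hintegrable v hv _)
          fun x => by linarith [(abs_le.1 (hclose x)).1]
    _ = ∫ x, f v x ∂μ + τ + 4 * δ := by ring

end Discriminators

section Equilibrium

variable {n d : ℕ} {φ : ℝ → ℝ} {μ : Measure (EuclideanSpace ℝ (Fin d))} [IsProbabilityMeasure μ]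

lemma payoff_const_half {G : EuclideanSpace ℝ (Fin n) → EuclideanSpace ℝ (Fin d)}
    (hG : Measurable G) : payoff φ μ G (fun _ => 1 / 2) = 2 * φ (1 / 2) := by
  have : IsProbabilityMeasure (generatedLaw G) := Measure.isProbabilityMeasure_map hG.aemeasurable
  simp only [payoff, integral_const, probReal_univ, one_smul, sub_half]
  ring

lemma concaveOn_add_one_sub_le (hφ : ConcaveOn ℝ (Icc 0 1) φ) {t : ℝ} (ht : t ∈ Icc (0 : ℝ) 1) :
    φ t + φ (1 - t) ≤ 2 * φ (1 / 2) := by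
  have hconcave := hφ.2 ht (Icc.mem_iff_one_sub_mem.1 ht) one_half_pos.le one_half_pos.le
    (add_halves 1)
  rw [smul_eq_mul, smul_eq_mul, smul_eq_mul, smul_eq_mul, ← mul_add, ← mul_add, add_sub_cancel,
    mul_one] at hconcave
  linarith

lemma integral_add_integral_one_sub_le (hφ : ConcaveOn ℝ (Icc 0 1) φ)
    {D : EuclideanSpace ℝ (Fin d) → ℝ} (hD : ∀ x, D x ∈ Icc 0 1)
    (hint : Integrable (fun x => φ (D x)) μ) (hint' : Integrable (fun x => φ (1 - D x)) μ) :
    (∫ x, φ (D x) ∂μ) + ∫ x, φ (1 - D x) ∂μ ≤ 2 * φ (1 / 2) := by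
  rw [← integral_add hint hint']
  simpa using integral_mono (hint.add hint') (integrable_const (2 * φ (1 / 2)))
    fun x => concaveOn_add_one_sub_le hφ (hD x)

lemma isApproxPureEquilibrium_half (hφ : ConcaveOn ℝ (Icc 0 1) φ) (hφc : ContinuousOn φ (Icc 0 1))
    {𝒢 : Set (EuclideanSpace ℝ (Fin n) → EuclideanSpace ℝ (Fin d))}
    (h𝒢 : ∀ G ∈ 𝒢, Measurable G) {𝒟 : Set (EuclideanSpace ℝ (Fin d) → ℝ)}
    (h𝒟 : ∀ D ∈ 𝒟, Continuous D) (h𝒟01 : ∀ D ∈ 𝒟, ∀ x, D x ∈ Icc 0 1) {ε : ℝ} (hε : 0 ≤ ε)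
    {G₀ : EuclideanSpace ℝ (Fin n) → EuclideanSpace ℝ (Fin d)} (hG₀ : G₀ ∈ 𝒢)
    (hle : ∀ D ∈ 𝒟, ∫ x, φ (1 - D x) ∂generatedLaw G₀ ≤ ∫ x, φ (1 - D x) ∂μ + ε) :
    IsApproxPureEquilibrium (payoff φ μ) 𝒢 (insert (fun _ => 1 / 2) 𝒟) ε (2 * φ (1 / 2)) G₀
      (fun _ => 1 / 2) := by
  have hint : ∀ D : EuclideanSpace ℝ (Fin d) → ℝ, Continuous D → (∀ x, D x ∈ Icc 0 1) →
      Integrable (fun x => φ (D x)) μ := fun D hD hD01 => by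
    obtain ⟨b, hb⟩ := isCompact_Icc.exists_bound_of_continuousOn hφc
    exact .of_bound (hφc.comp_continuous hD hD01).aestronglyMeasurable b
      (ae_of_all _ fun x => hb _ (hD01 x))
  refine ⟨hG₀, mem_insert _ _, ?_, fun G hG => ?_⟩
  · rintro D (rfl | hD)
    · rw [payoff_const_half (h𝒢 G₀ hG₀)]
      linarith
    · have hconcave := integral_add_integral_one_sub_le hφ (h𝒟01 D hD)
        (hint D (h𝒟 D hD) (h𝒟01 D hD)) (hint _ (continuous_const.sub (h𝒟 D hD))
          fun x => Icc.mem_iff_one_sub_mem.1 (h𝒟01 D hD x))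
      rw [payoff]
      linarith [hle D hD]
  · rw [payoff_const_half (h𝒢 G hG)]
    linarith

end Equilibrium

section SampleSize

variable {p : ℕ} {Δ ε Λ : ℝ}

/-- The left-hand side bounds the size of a net of radius `p / (8 * Λ)` in the unit ball of `ℝᵖ`. -/
lemma one_add_pow_le_exp (hΛ : 2 ≤ Λ) (hp : 0 < p) :
    (1 + 2 / (p / (8 * Λ))) ^ p ≤ Real.exp (6 * p * Real.log Λ) := by
  have hp' : (1 : ℝ) ≤ p := by exact_mod_cast hp
  have hbase : 1 + 2 / (p / (8 * Λ)) ≤ Λ ^ 6 := by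
    calc 1 + 2 / (p / (8 * Λ)) ≤ 1 + 2 / (1 / (8 * Λ)) := by gcongr
      _ = 1 + 16 * Λ := by rw [div_div_eq_mul_div]; ring
      _ ≤ 2 ^ 5 * Λ := by linarith
      _ ≤ Λ ^ 5 * Λ := by gcongr
      _ = Λ ^ 6 := by ring
  calc (1 + 2 / (p / (8 * Λ))) ^ p ≤ (Λ ^ 6) ^ p := by gcongr
    _ = Real.exp (6 * p * Real.log Λ) := by
      rw [← pow_mul, ← Real.exp_log (by positivity : 0 < Λ ^ (6 * p)), Real.log_pow]
      push_cast
      rfl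

lemma exists_sample_size (hε : 0 < ε) (hεΔ : ε ≤ 4 * Δ) (hΛ : 2 ≤ Λ) (hp : 0 < p) :
    ∃ T : ℕ, 0 < T ∧
      (1 + 2 / (p / (8 * Λ))) ^ p * Real.exp (-(2 * T * (ε / 2) ^ 2 / (2 * Δ) ^ 2)) < 1 ∧
      ((7 * T * p : ℕ) : ℝ) ≤ 560 * (Δ ^ 2 * (p : ℝ) ^ 2 * Real.log Λ / ε ^ 2) := by
  have hΔ : 0 < Δ := by linarith
  have hp' : (1 : ℝ) ≤ p := by exact_mod_cast hp
  have hlog : 1 / 2 ≤ Real.log Λ := by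
    linarith [Real.log_two_gt_d9, Real.log_le_log two_pos hΛ]
  set X := Δ ^ 2 * p * Real.log Λ / ε ^ 2 with hX
  have hX_ge : 1 / 32 ≤ X := by
    calc (1 / 32 : ℝ) = (ε / 4) ^ 2 * 1 * (1 / 2) / ε ^ 2 := by field_simp; norm_num
      _ ≤ X := by rw [hX]; gcongr; linarith
  refine ⟨⌊48 * X⌋₊ + 1, Nat.succ_pos _, ?_, ?_⟩
  · have hlt : 6 * p * Real.log Λ <
        2 * (⌊48 * X⌋₊ + 1 : ℕ) * (ε / 2) ^ 2 / (2 * Δ) ^ 2 := by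
      calc 6 * p * Real.log Λ = 2 * (48 * X) * (ε / 2) ^ 2 / (2 * Δ) ^ 2 := by
            rw [hX]; field_simp; norm_num
        _ < 2 * (⌊48 * X⌋₊ + 1 : ℕ) * (ε / 2) ^ 2 / (2 * Δ) ^ 2 := by
            have := Nat.lt_floor_add_one (48 * X)
            push_cast
            gcongr
    calc _ ≤ Real.exp (6 * p * Real.log Λ) *
          Real.exp (-(2 * (⌊48 * X⌋₊ + 1 : ℕ) * (ε / 2) ^ 2 / (2 * Δ) ^ 2)) := by
          gcongr
          exact one_add_pow_le_exp hΛ hp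
      _ < 1 := by
          rw [← Real.exp_add, Real.exp_lt_one_iff]
          linarith
  · have hfloor := Nat.floor_le (by linarith : 0 ≤ 48 * X)
    calc ((7 * (⌊48 * X⌋₊ + 1) * p : ℕ) : ℝ) ≤ 7 * (48 * X + 32 * X) * p := by
          push_cast
          gcongr
          linarith
      _ = 560 * (Δ ^ 2 * (p : ℝ) ^ 2 * Real.log Λ / ε ^ 2) := by rw [hX]; ring

end SampleSize

lemma integrable_stdGaussian_of_lipschitzWith {l : ℕ} {F : Type*} [NormedAddCommGroup F]
    {K : NNReal} {G : EuclideanSpace ℝ (Fin l) → F} (hG : LipschitzWith K G) :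
    Integrable G (stdGaussian (EuclideanSpace ℝ (Fin l))) := by
  refine .mono' ((IsGaussian.integrable_id.norm.const_mul (K : ℝ)).add (integrable_const ‖G 0‖))
    hG.continuous.aestronglyMeasurable (ae_of_all _ fun h => ?_)
  have hdist := hG.dist_le_mul h 0
  rw [dist_eq_norm, dist_zero_right] at hdist
  have := norm_le_norm_sub_add (G h) (G 0)
  simp only [Pi.add_apply, id]
  linarith

end GAN

theorem theorem4p3_general {𝒜 : Set (ℝ → ℝ)} (hrelu : GAN.relu ∈ 𝒜)
    (h𝒜 : ∀ σ ∈ 𝒜, Measurable σ) {k p l d : ℕ} (hk : 2 ≤ k) {φ : ℝ → ℝ} {Δ : ℝ} {L Lφ : NNReal}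
    (hφ : ConcaveOn ℝ (Icc 0 1) φ) (hφΔ : ∀ t ∈ Icc (0 : ℝ) 1, φ t ∈ Icc (-Δ) Δ)
    (hφL : LipschitzOnWith Lφ φ (Icc 0 1))
    {𝒢 : Set (EuclideanSpace ℝ (Fin l) → EuclideanSpace ℝ (Fin d))}
    (h𝒢 : 𝒢 ⊆ GAN.generatorNets 𝒜 k p l d) (hint : ∀ G ∈ 𝒢, Integrable G (stdGaussian _))
    {𝒱 : Set (EuclideanSpace ℝ (Fin p))}
    {D : EuclideanSpace ℝ (Fin p) → EuclideanSpace ℝ (Fin d) → ℝ}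
    (h𝒱 : 𝒱 ⊆ Metric.closedBall 0 1) (hD : ∀ v ∈ 𝒱, D v ∈ GAN.discriminatorNets 𝒜 k p d)
    (hDL : ∀ x, LipschitzOnWith L (fun v => D v x) 𝒱) (hDc : ∀ v ∈ 𝒱, Continuous (D v))
    {μ : Measure (EuclideanSpace ℝ (Fin d))} [IsProbabilityMeasure μ]
    (happrox : ∀ᵐ x ∂μ, ∀ η : ℝ, 0 < η → ∃ G ∈ 𝒢, ∫ h, ‖G h - x‖ ∂stdGaussian _ ≤ η)
    {ε Λ : ℝ} (hε : 0 < ε) (hεΔ : ε ≤ 4 * Δ) (hΛ : 2 ≤ Λ) (hLΛ : L * Lφ * p / ε ≤ Λ) :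
    ∃ N : ℕ,
      (N : ℝ) ≤ 560 * (Δ ^ 2 * (p : ℝ) ^ 2 * Real.log Λ / ε ^ 2) ∧
      (∀ G ∈ 𝒢, GAN.ignoreFirst G ∈ GAN.generatorNets 𝒜 (k + 1) N (l + 1) d) ∧
      (∀ v ∈ 𝒱, D v ∈ GAN.discriminatorNets 𝒜 (k + 1) N d) ∧
      ∃ G₀ ∈ GAN.generatorNets 𝒜 (k + 1) N (l + 1) d,
      ∃ D₀ ∈ GAN.discriminatorNets 𝒜 (k + 1) N d,
        GAN.IsApproxPureEquilibrium (GAN.payoff φ μ)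
          (GAN.generatorNets 𝒜 (k + 1) N (l + 1) d) (insert D₀ (D '' 𝒱))
          ε (2 * φ (1 / 2)) G₀ D₀ := by
  obtain ⟨k, rfl⟩ := Nat.exists_eq_add_of_le' hk
  obtain ⟨G, hG, -⟩ := happrox.exists.choose_spec 1 one_pos
  obtain ⟨A, hA, -⟩ := h𝒢 hG
  have hkp : k + 2 + d ≤ p + 1 := A.depth_add_width_le.trans (Nat.succ_le_succ hA)
  have hp : 0 < p := by omega
  obtain ⟨T, hT, hexp, hN⟩ := GAN.exists_sample_size hε hεΔ hΛ hp
  have hpN : p ≤ T * p := Nat.le_mul_of_pos_left p hT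
  have hflip : ∀ v ∈ 𝒱, ∀ x, 1 - D v x ∈ Icc (0 : ℝ) 1 := fun v hv x =>
    Icc.mem_iff_one_sub_mem.1 ((hD v hv).2 x)
  have hflipL : ∀ x, LipschitzOnWith L (fun v => 1 - D v x) 𝒱 := fun x =>
    .of_dist_le_mul fun v hv w hw => (dist_sub_left _ _ _).trans_le ((hDL x).dist_le_mul v hv w hw)
  have hΛ₀ : 0 < Λ := by linarith
  have hradius : ((Lφ * L : NNReal) : ℝ) * (p / (8 * Λ)) ≤ ε / 8 := by
    rw [div_le_iff₀ hε] at hLΛ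
    rw [NNReal.coe_mul, mul_div_assoc', div_le_div_iff₀ (by positivity) (by positivity)]
    linarith
  obtain ⟨G₀, hG₀, hle⟩ := GAN.exists_generator_forall_integral_le hrelu h𝒜 h𝒢 hint happrox h𝒱
    (f := fun v x => φ (1 - D v x)) (K := Lφ * L) (τ := ε / 2) (δ := ε / 8)
    (fun v hv => hφL.continuousOn.comp_continuous (continuous_const.sub (hDc v hv)) (hflip v hv))
    (fun v hv x => hφΔ _ (hflip v hv x)) (fun x => hφL.comp (hflipL x) fun v hv => hflip v hv x)
    hT (by positivity) (by positivity) (div_pos (by exact_mod_cast hp) (by positivity)) hradius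
    (by rwa [finrank_euclideanSpace_fin, sub_neg_eq_add, ← two_mul])
  refine ⟨7 * T * p, hN, fun G hG => GAN.ignoreFirst_mem_generatorNets hrelu (h𝒢 hG) (by lia),
    fun v hv => GAN.discriminatorNets_subset_succ hrelu (by lia) (hD v hv), G₀, hG₀, _,
    GAN.const_mem_discriminatorNets hrelu ⟨by norm_num, by norm_num⟩ (by lia),
    GAN.isApproxPureEquilibrium_half hφ hφL.continuousOn
      (fun G hG => GAN.measurable_of_mem_generatorNets h𝒜 hG) (forall_mem_image.2 hDc)
      (forall_mem_image.2 fun v hv => (hD v hv).2) hε.le hG₀ (forall_mem_image.2 fun v hv => ?_)⟩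
  linarith [hle v hv]

theorem theorem4p3 :
    ∃ C : ℝ, 0 < C ∧
      ∀ (𝒜 : Set (ℝ → ℝ)), GAN.relu ∈ 𝒜 → (∀ σ ∈ 𝒜, Measurable σ) →
      ∀ (k p l d : ℕ), 2 ≤ k →
      -- the measuring function
      ∀ (φ : ℝ → ℝ) (Δ : ℝ) (L L' Lφ : NNReal),
        ConcaveOn ℝ (Icc 0 1) φ → (∀ t ∈ Icc (0 : ℝ) 1, φ t ∈ Icc (-Δ) Δ) →
        LipschitzOnWith Lφ φ (Icc 0 1) →
      -- the generators
      ∀ (U : Set (EuclideanSpace ℝ (Fin p)))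
        (G : EuclideanSpace ℝ (Fin p) → EuclideanSpace ℝ (Fin l) → EuclideanSpace ℝ (Fin d)),
        U ⊆ Metric.closedBall 0 1 →
        (∀ u ∈ U, G u ∈ GAN.generatorNets 𝒜 k p l d) →
        (∀ h, LipschitzOnWith L (fun u => G u h) U) →
        (∀ u ∈ U, LipschitzWith L' (G u)) →
      -- the discriminators
      ∀ (𝒱 : Set (EuclideanSpace ℝ (Fin p)))
        (D : EuclideanSpace ℝ (Fin p) → EuclideanSpace ℝ (Fin d) → ℝ),
        𝒱 ⊆ Metric.closedBall 0 1 →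
        (∀ v ∈ 𝒱, D v ∈ GAN.discriminatorNets 𝒜 k p d) →
        (∀ x, LipschitzOnWith L (fun v => D v x) 𝒱) →
        (∀ v ∈ 𝒱, LipschitzWith L' (D v)) →
      -- the real distribution; the generators approximate the point masses at its points
      ∀ (μ : Measure (EuclideanSpace ℝ (Fin d))), IsProbabilityMeasure μ →
        (∀ᵐ x ∂μ, ∀ η : ℝ, 0 < η →
          ∃ u ∈ U, ∫ h, ‖G u h - x‖ ∂(stdGaussian (EuclideanSpace ℝ (Fin l))) ≤ η) →
      ∀ ε : ℝ, 0 < ε → ε ≤ 4 * Δ → 1 ≤ L' → 2 ≤ (L * L' * Lφ * p / ε : ℝ) →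
      ∃ N : ℕ,
        (N : ℝ) ≤ C * (Δ ^ 2 * (p : ℝ) ^ 2 * Real.log (L * L' * Lφ * p / ε) / ε ^ 2) ∧
        (∀ u ∈ U, GAN.ignoreFirst (G u) ∈ GAN.generatorNets 𝒜 (k + 1) N (l + 1) d) ∧
        (∀ v ∈ 𝒱, D v ∈ GAN.discriminatorNets 𝒜 (k + 1) N d) ∧
        ∃ G₀ ∈ GAN.generatorNets 𝒜 (k + 1) N (l + 1) d,
        ∃ D₀ ∈ GAN.discriminatorNets 𝒜 (k + 1) N d,
          GAN.IsApproxPureEquilibrium (GAN.payoff φ μ)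
            (GAN.generatorNets 𝒜 (k + 1) N (l + 1) d) (insert D₀ (D '' 𝒱))
            ε (2 * φ (1 / 2)) G₀ D₀ := by
  refine ⟨560, by norm_num, ?_⟩
  intro 𝒜 hrelu h𝒜 k p l d hk φ Δ L L' Lφ hφ hφΔ hφL U G _ hG _ hGL' 𝒱 D h𝒱 hD hDL hDL' μ _
    happrox ε hε hεΔ hL' hΛ
  have hLΛ : (L * Lφ * p / ε : ℝ) ≤ L * L' * Lφ * p / ε := by
    gcongr
    exact le_mul_of_one_le_right L.2 hL'
  simpa only [forall_mem_image] using theorem4p3_general hrelu h𝒜 hk hφ hφΔ hφL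
    (𝒢 := G '' U) (image_subset_iff.2 hG)
    (forall_mem_image.2 fun u hu => GAN.integrable_stdGaussian_of_lipschitzWith (hGL' u hu)) h𝒱 hD
    hDL (fun v hv => (hDL' v hv).continuous) (by simpa only [exists_mem_image] using happrox)
    hε hεΔ hΛ hLΛ
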